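/- Conventions. Let $P$ be a poset. Write $p\prec q$ if $q$ covers $p$; a $t$-chain of length $n$ is a chain $c=(c_0<c_1<\dots<c_n=t)$, and it is unrefinable if $c_j\prec c_{j+1}$ for all $j$. For $p\in P$ let $P_{\prec p}=\{x\in P: x\prec p\}$ and let $d(p)=\max\{n : c_0\prec c_1\prec\dots\prec c_n=p\}$. The poset $P$ is filtered if $d\colon P\to\mathbb N$ is well defined (all these maxima exist) and strictly order preserving; its degree is $d(P)=\max_{p} d(p)\in\mathbb N\cup\{\infty\}$. A bounded poset is a filtered poset with a minimum $\hat 0$ and a maximum $\hat 1$ (it may be infinite and non-pure). For $Q\subseteq P$ put $\langle Q\rangle=\{x\in P: x\le y\text{ for some }y\in Q\}$. Let $P$ be a bounded poset. A coatom ordering $\ll$ of $P$ is a family of well-orders $\ll_c$ (written as strict orders) on $P_{\prec c_0}$, one for every unrefinable $\hat 1$-chain $c=(c_0\prec\dots\prec c_n=\hat 1)$, $n\ge 0$. For such a chain with $n\ge1$ and $c'=(c_1\prec\dots\prec c_n=\hat 1)$ set $$C(c)=\{x\prec c_0 : x<h\prec c_1\text{ for some }h\ll_{c'}c_0\},$$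 and set $C(\hat 1)=\emptyset$ for the chain of length $0$. The pair $(P,\ll)$ is dual CL-shellable if, for every unrefinable $\hat 1$-chain $c$: (CL0) every initial segment of $\ll_c$ (including the whole of $P_{\prec c_0}$) is finite or order isomorphic to $(\mathbb N,\le)$; (CL1) $C(c)$ is an initial segment of $\ll_c$; (CL2) whenever $h',h\in P_{\prec c_0}$ with $h'\ll_c h$, and $p\in P$ with $p<h$ and $p<h'$, there are $h''\in P_{\prec c_0}$ and $q\prec h$ with $h''\ll_c h$ and $p\le q<h''$. Let $R$ be a commutative ring with unit. For a poset $Q$ and a functor $F\colon Q^{\mathrm{op}}\to R\text{-mod}$, let $H^i(Q;F)$ be the value at $F$ of the $i$-th right derived functor of $\lim\colon \mathrm{Fun}(Q^{\mathrm{op}},R\text{-mod})\to R\text{-mod}$. For a functor $F$ on $P^{\mathrm{op}}$ and a sub-poset $Q\subseteq P$, $\lim_QF$ and $H^i(Q;F)$ are taken for the restriction of $F$ to $Q^{\mathrm{op}}$. **Theorem.** Let $(P,\ll)$ be a dual CL-shellable pair, let $1\le i\le d(P)-1$, and let $F\colon P^{\mathrm{op}}\to R\text{-mod}$ be a functor that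 is stable at degree $i$, that is, for every unrefinable $\hat 1$-chain $c=(c_0\prec\dots\prec c_i=\hat 1)$ of length $i$ the natural map $$F(c_0)\to\lim_{\langle C(c)\rangle}F$$ is surjective. Then $$H^i(P\setminus\{\hat 1\};F)=0.$$ -/

import Mathlib

open CategoryTheory CategoryTheory.Limits Opposite

universe u v w

/-! ### Unrefinable chains, degree, filtered posets -/

/-- An unrefinable chain `p = c₀ ⋖ c₁ ⋖ ⋯ ⋖ cₙ = t` with largest element `t` (a "`t`-chain")
and least element `p`.  It is built by adding new least elements at the front. -/
inductive UnrefinableChain {P : Type v} [PartialOrder P] (t : P) : P → Type v where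
  | nil : UnrefinableChain t t
  | cons {p q : P} (h : p ⋖ q) (c : UnrefinableChain t q) : UnrefinableChain t p

/-- The length `n` of the chain `c₀ ⋖ c₁ ⋖ ⋯ ⋖ cₙ`. -/
def UnrefinableChain.length {P : Type v} [PartialOrder P] {t : P} :
    ∀ {p : P}, UnrefinableChain t p → ℕ
  | _, .nil => 0
  | _, .cons _ c => c.length + 1

/-- The lengths of the unrefinable chains with largest element `p`. -/
def chainLengths {P : Type v} [PartialOrder P] (p : P) : Set ℕ :=
  {n | ∃ (q : P) (c : UnrefinableChain p q), c.length = n}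

/-- The degree `d(p)`: the maximal length of an unrefinable chain with largest element `p`
(this maximum exists in a filtered poset, see `FilteredPoset`). -/
noncomputable def posetDeg {P : Type v} [PartialOrder P] (p : P) : ℕ :=
  sSup (chainLengths p)

/-- A poset is filtered if the degree map `d : P → ℕ` is well defined (that is, the maximum
defining it exists) and strictly order preserving. -/
structure FilteredPoset (P : Type v) [PartialOrder P] : Prop where
  bddAbove_chainLengths : ∀ p : P, BddAbove (chainLengths p)
  strictMono_posetDeg : StrictMono (posetDeg : P → ℕ)

/-- The degree `d(P) = max {d(p) | p ∈ P} ∈ ℕ ∪ {∞}` of a poset. -/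
noncomputable def posetDegree (P : Type v) [PartialOrder P] : ℕ∞ :=
  ⨆ p : P, (posetDeg p : ℕ∞)

/-! ### Recursive coatom orderings -/

/-- A coatom ordering: for every unrefinable `⊤`-chain `c` (with least element `p`) a well-order
`≪_c` (given as a strict order) on the set of elements covered by `p`. -/
structure CoatomOrdering (P : Type v) [PartialOrder P] [OrderTop P] where
  lt : ∀ {p : P}, UnrefinableChain (⊤ : P) p → {x : P // x ⋖ p} → {x : P // x ⋖ p} → Prop
  isWellOrder : ∀ {p : P} (c : UnrefinableChain (⊤ : P) p), IsWellOrder {x : P // x ⋖ p} (lt c)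

/-- The set `C(c) = {x ⋖ c₀ | x < h ⋖ c₁ for some h ≪_{c'} c₀}`, where `c' = c₁ ⋖ ⋯ ⋖ ⊤`, for a
chain `c` of positive length, and `C(⊤) = ∅`. -/
def CoatomOrdering.C {P : Type v} [PartialOrder P] [OrderTop P] (O : CoatomOrdering P) :
    ∀ {p : P}, UnrefinableChain (⊤ : P) p → Set {x : P // x ⋖ p}
  | _, .nil => ∅
  | _, .cons (p := p) (q := q) hpq c' =>
      {x | ∃ h : {y : P // y ⋖ q}, O.lt c' h ⟨p, hpq⟩ ∧ x.1 < h.1}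

/-- `S` is an initial segment (possibly everything) for the strict order `r`. -/
def IsInitialSegment {α : Type v} (r : α → α → Prop) (S : Set α) : Prop :=
  ∀ x ∈ S, ∀ y, r y x → y ∈ S

/-- The axioms CL0, CL1 and CL2 of a recursive coatom ordering. -/
structure CoatomOrdering.IsRecursive {P : Type v} [PartialOrder P] [OrderTop P]
    (O : CoatomOrdering P) : Prop where
  cl0 : ∀ {p : P} (c : UnrefinableChain (⊤ : P) p) (S : Set {x : P // x ⋖ p}),
    IsInitialSegment (O.lt c) S →
      S.Finite ∨ Nonempty (Subrel (O.lt c) (· ∈ S) ≃r ((· < ·) : ℕ → ℕ → Prop))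
  cl1 : ∀ {p : P} (c : UnrefinableChain (⊤ : P) p), IsInitialSegment (O.lt c) (O.C c)
  cl2 : ∀ {p : P} (c : UnrefinableChain (⊤ : P) p) (h' h : {x : P // x ⋖ p}), O.lt c h' h →
    ∀ y : P, y < h.1 → y < h'.1 →
      ∃ (h'' : {x : P // x ⋖ p}) (q : P), q ⋖ h.1 ∧ O.lt c h'' h ∧ y ≤ q ∧ q < h''.1

/-- `(P, ≪)` is a dual CL-shellable pair: `P` is a bounded (in particular filtered) poset and `≪`
is a recursive coatom ordering of it. -/
structure IsDualCLShellable (P : Type v) [PartialOrder P] [BoundedOrder P]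
    (O : CoatomOrdering P) : Prop where
  filtered : FilteredPoset P
  recursive : O.IsRecursive

/-- The sub-poset `⟨C(c)⟩ = {x | x ≤ y for some y ∈ C(c)}` of `P`. -/
def CoatomOrdering.ideal {P : Type v} [PartialOrder P] [OrderTop P] (O : CoatomOrdering P)
    {p : P} (c : UnrefinableChain (⊤ : P) p) : Set P :=
  {x | ∃ y ∈ O.C c, x ≤ y.1}

theorem CoatomOrdering.le_of_mem_ideal {P : Type v} [PartialOrder P] [OrderTop P]
    (O : CoatomOrdering P) {p : P} (c : UnrefinableChain (⊤ : P) p) :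
    ∀ x ∈ O.ideal c, x ≤ p := by
  rintro x ⟨y, -, hxy⟩
  exact hxy.trans y.2.1.le

/-! ### Limits and higher limits of functors `Pᵒᵖ ⥤ R-mod` -/

instance hasLimitsOfShape_op_moduleCat (R : Type u) [CommRing R] (Q : Type v) [PartialOrder Q]
    [Small.{w} Q] : HasLimitsOfShape Qᵒᵖ (ModuleCat.{w} R) :=
  have : Small.{w} Qᵒᵖ := small_map equivToOpposite.symm
  ModuleCat.hasLimitsOfShape

instance lim_additive_moduleCat (R : Type u) [CommRing R] (Q : Type v) [PartialOrder Q]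
    [Small.{w} Q] : (lim : (Qᵒᵖ ⥤ ModuleCat.{w} R) ⥤ ModuleCat.{w} R).Additive where
  map_add {F G f g} := by
    apply limit.hom_ext
    intro j
    simp [Preadditive.add_comp, Preadditive.comp_add]

instance enoughInjectives_op_moduleCat (R : Type u) [CommRing R] [Small.{w} R] (Q : Type v)
    [PartialOrder Q] [Small.{w} Q] : EnoughInjectives (Qᵒᵖ ⥤ ModuleCat.{w} R) where
  presentation X := by
    have hprod : ∀ (J : Type v) [Small.{w} J], HasProductsOfShape J (ModuleCat.{w} R) := fun J _ =>
      have : Small.{w} (Discrete J) := small_map discreteEquiv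
      ModuleCat.hasLimitsOfShape
    have := hprod Qᵒᵖ
    have : ∀ a b : Qᵒᵖ, HasProductsOfShape (a ⟶ b) (ModuleCat.{w} R) := fun a b => hprod _
    let adj := fun q : Qᵒᵖ => evaluationAdjunctionLeft (ModuleCat.{w} R) q
    let I : Qᵒᵖ → (Qᵒᵖ ⥤ ModuleCat.{w} R) := fun q =>
      (evaluationRightAdjoint (ModuleCat.{w} R) q).obj (Injective.under (X.obj q))
    have : ∀ q, Injective (I q) := fun q => (adj q).map_injective _ inferInstance
    let f : ∀ q : Qᵒᵖ, X ⟶ I q := fun q => (adj q).homEquiv X _ (Injective.ι (X.obj q))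
    have : Mono (Pi.lift f) := by
      have : ∀ q, Mono ((Pi.lift f).app q) := fun q => by
        have h : (Pi.lift f).app q ≫ ((Pi.π I q).app q ≫ (adj q).counit.app _) =
            Injective.ι (X.obj q) := by
          rw [← Category.assoc, ← NatTrans.comp_app, Pi.lift_π]
          have := (adj q).homEquiv_counit (X := X) (g := f q)
          simp only [f, Equiv.symm_apply_apply] at this
          exact this.symm
        have : Mono ((Pi.lift f).app q ≫ ((Pi.π I q).app q ≫ (adj q).counit.app _)) := by
          rw [h]; infer_instance
        exact mono_of_mono _ ((Pi.π I q).app q ≫ (adj q).counit.app _)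
      exact NatTrans.mono_of_mono_app _
    exact ⟨{ J := ∏ᶜ I, f := Pi.lift f }⟩

/-- The restriction of a functor `F : Pᵒᵖ ⥤ R-mod` to a sub-poset. -/
abbrev restrictTo {R : Type u} [CommRing R] {P : Type v} [PartialOrder P]
    (F : Pᵒᵖ ⥤ ModuleCat.{w} R) (S : Set P) : (↥S)ᵒᵖ ⥤ ModuleCat.{w} R :=
  (Subtype.mono_coe (· ∈ S)).functor.op ⋙ F

/-- The natural map `F(p) ⟶ lim_S F`, for a sub-poset `S` of `P_{≤ p}`, induced by the maps
`F(x ≤ p) : F(p) ⟶ F(x)`. -/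
noncomputable def toLim {R : Type u} [CommRing R] {P : Type v} [PartialOrder P] [Small.{w} P]
    (F : Pᵒᵖ ⥤ ModuleCat.{w} R) (p : P) (S : Set P) (hS : ∀ x ∈ S, x ≤ p) :
    F.obj (op p) ⟶ limit (restrictTo F S) :=
  limit.lift (restrictTo F S)
    { pt := F.obj (op p)
      π :=
        { app := fun x => F.map (homOfLE (hS x.unop.1 x.unop.2)).op
          naturality := by
            intro x y f
            exact (Category.id_comp _).trans (F.map_comp _ _) } }

/-- The cohomology `H^i(Q; F)`: the value at `F` of the `i`-th right derived functor of
`lim : Fun(Qᵒᵖ, R-mod) ⥤ R-mod`. -/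
noncomputable def posetCohomology {R : Type u} [CommRing R] [Small.{w} R] (Q : Type v)
    [PartialOrder Q] [Small.{w} Q] (F : Qᵒᵖ ⥤ ModuleCat.{w} R) (i : ℕ) : ModuleCat.{w} R :=
  ((lim : (Qᵒᵖ ⥤ ModuleCat.{w} R) ⥤ ModuleCat.{w} R).rightDerived i).obj F

/-- `F` is stable at `i` (for the coatom ordering `≪`): for every unrefinable `⊤`-chain `c` of
length `i`, with least element `c₀ = p`, the natural map `F(c₀) ⟶ lim_{⟨C(c)⟩} F` is surjective. -/
def IsStableAt {R : Type u} [CommRing R] {P : Type v} [PartialOrder P] [OrderTop P] [Small.{w} P]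
    (O : CoatomOrdering P) (F : Pᵒᵖ ⥤ ModuleCat.{w} R) (i : ℕ) : Prop :=
  ∀ (p : P) (c : UnrefinableChain (⊤ : P) p), c.length = i →
    Function.Surjective (toLim F p (O.ideal c) (O.le_of_mem_ideal c))

/-!
Elements of `lim_U A`, for `U` a lower set of `Q = P ∖ {⊤}`, are compatible families of elements of
`A(x)`, `x ∈ U`: sections of `A` over `U`.  Let `F → I⁰ → I¹ → ⋯` be an injective resolution on
`Q`, and `Zʲ = ker (Iʲ → Iʲ⁺¹)`, so that `Z⁰ = F`.  Then `Hⁱ(Q; F) = 0` says that global sections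
of `Zⁱ` lift to `Iⁱ⁻¹` (`isZero_posetCohomology_succ`).  The two ingredients are the following.

* Lifting along `≪` (`exists_section_lift`, `IsKerStableAt.exists_section_lift`).  Let `c` be a
  chain of length `n` and `S` an initial segment of `≪_c`.  A section of `Zʲ⁺¹` over `⟨S⟩` is lifted
  to `Iʲ` on one `P_{≤ h}`, `h ∈ S`, at a time.  By CL2 the overlap of `P_{≤ h}` with the earlier
  ones is `⟨C(h ⋖ c)⟩`; on it two lifts differ by a section of `Zʲ`, which extends to `P_{≤ h}` and
  can be subtracted as soon as `Zʲ` is stable at `n + 1`.  Well-founded recursion along `≪_c` does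
  this for arbitrary well-orders, so no limit argument is needed when `S` is infinite.
* Dimension shifting (`IsKerStableAt.of_exact`).  If `Zʲ` is stable at `n + 1`, then `Zʲ⁺¹` is
  stable at `n`: by CL1, lifting applies to `S = C(c)`, and the lift in `Iʲ` extends from `⟨C(c)⟩`
  to `P_{≤ c₀}`, as sections of injectives do (`exists_resMap_eq_of_injective`).

As `Z⁰ = F` is stable at `i`, the functor `Zⁱ⁻¹` is stable at `1`.  Lifting for the chain of length
`0` and the set of all coatoms, which generates `Q`, then lifts the global sections of `Zⁱ`.
-/

/-! ### Local sections of functors on a poset -/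

section Sections

variable {R : Type u} [CommRing R] {Q : Type v} [PartialOrder Q]

/-- The restriction map `A(y) → A(x)` of a functor `A : Qᵒᵖ ⥤ R-mod`, for `x ≤ y`. -/
def resMap (A : Qᵒᵖ ⥤ ModuleCat.{w} R) {x y : Q} (h : x ≤ y) :
    A.obj (op y) →ₗ[R] A.obj (op x) :=
  (A.map (homOfLE h).op).hom

@[simp]
theorem resMap_refl (A : Qᵒᵖ ⥤ ModuleCat.{w} R) {x : Q} (h : x ≤ x) (a : A.obj (op x)) :
    resMap A h a = a := by
  simp [resMap]

@[simp]
theorem resMap_resMap (A : Qᵒᵖ ⥤ ModuleCat.{w} R) {x y z : Q} (h : x ≤ y) (h' : y ≤ z)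
    (a : A.obj (op z)) : resMap A h (resMap A h' a) = resMap A (h.trans h') a := by
  have : (homOfLE (h.trans h')).op = (homOfLE h').op ≫ (homOfLE h).op := rfl
  simp [resMap, this]

theorem app_resMap {A B : Qᵒᵖ ⥤ ModuleCat.{w} R} (f : A ⟶ B) {x y : Q} (h : x ≤ y)
    (a : A.obj (op y)) :
    (f.app (op x)).hom (resMap A h a) = resMap B h ((f.app (op y)).hom a) :=
  NatTrans.naturality_apply f (homOfLE h).op a

/-- `s` is a section of `A` over the subset `U`, that is, an element of `lim_U A`.  It is encoded
as a family on all of `Q` whose values outside `U` are irrelevant; only used for `U` a lower set. -/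
def IsSectionOn (A : Qᵒᵖ ⥤ ModuleCat.{w} R) (U : Set Q) (s : ∀ x : Q, A.obj (op x)) : Prop :=
  ∀ (x y : Q) (h : y ≤ x), x ∈ U → resMap A h (s x) = s y

/-- Let `f : A ⟶ B`, and let `e h`, for `h` in a well-ordered set, be elements of `Q` such that
every section of `ker f` over the part of `Q_{≤ e h}` covered by the earlier `Q_{≤ e h'}` extends
to `Q_{≤ e h}`.  Then every section of `B` over `⋃ Q_{≤ e h}` that lifts to `A` at each `e h`
lifts to a section of `A`: the lift is extended over one `Q_{≤ e h}` at a time, a lift at `e h`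
being corrected by an element of `ker f`. -/
theorem exists_section_lift {A B : Qᵒᵖ ⥤ ModuleCat.{w} R} (f : A ⟶ B) {H : Type v}
    (r : H → H → Prop) [IsWellOrder H r] (e : H → Q) (g : ∀ x : Q, B.obj (op x))
    (hg : IsSectionOn B {x | ∃ h, x ≤ e h} g)
    (hlift : ∀ h, ∃ a, (f.app (op (e h))).hom a = g (e h))
    (hker : ∀ h, ∀ s : ∀ x : Q, A.obj (op x),
      IsSectionOn A {x | x ≤ e h ∧ ∃ h', r h' h ∧ x ≤ e h'} s →
      (∀ x, x ≤ e h → (∃ h', r h' h ∧ x ≤ e h') → (f.app (op x)).hom (s x) = 0) →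
      ∃ a, (f.app (op (e h))).hom a = 0 ∧
        ∀ x (hx : x ≤ e h), (∃ h', r h' h ∧ x ≤ e h') → resMap A hx a = s x) :
    ∃ t : ∀ x : Q, A.obj (op x), IsSectionOn A {x | ∃ h, x ≤ e h} t ∧
      ∀ x, (∃ h, x ≤ e h) → (f.app (op x)).hom (t x) = g x := by
  classical
  have wf : WellFounded r := IsWellFounded.wf
  let Good : ∀ h : H, (∀ h', r h' h → A.obj (op (e h'))) → A.obj (op (e h)) → Prop :=
    fun h prev a => (f.app (op (e h))).hom a = g (e h) ∧
      ∀ (h' : H) (hr : r h' h) (x : Q) (h1 : x ≤ e h) (h2 : x ≤ e h'),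
        resMap A h1 a = resMap A h2 (prev h' hr)
  let a : ∀ h : H, A.obj (op (e h)) :=
    wf.fix fun h prev => if hex : ∃ b, Good h prev b then hex.choose else 0
  have good : ∀ h, Good h (fun h' _ => a h') (a h) := by
    intro h
    induction h using wf.induction with
    | _ h ih =>
    have hex : ∃ b, Good h (fun h' _ => a h') b := by
      -- The values chosen before `h` agree on overlaps.
      have compat : ∀ h₁ h₂, r h₁ h → r h₂ h → ∀ (x : Q) (l₁ : x ≤ e h₁) (l₂ : x ≤ e h₂),
          resMap A l₁ (a h₁) = resMap A l₂ (a h₂) := by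
        intro h₁ h₂ r₁ r₂ x l₁ l₂
        rcases trichotomous_of r h₁ h₂ with h12 | rfl | h21
        · exact ((ih h₂ r₂).2 h₁ h12 x l₂ l₁).symm
        · rfl
        · exact (ih h₁ r₁).2 h₂ h21 x l₁ l₂
      obtain ⟨a₀, ha₀⟩ := hlift h
      let s : ∀ x : Q, A.obj (op x) := fun x =>
        if hx : x ≤ e h ∧ ∃ h', r h' h ∧ x ≤ e h' then
          resMap A hx.1 a₀ - resMap A hx.2.choose_spec.2 (a hx.2.choose) else 0
      have hs : ∀ (x : Q) (h1 : x ≤ e h) (h' : H) (hr : r h' h) (h2 : x ≤ e h'),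
          s x = resMap A h1 a₀ - resMap A h2 (a h') := by
        intro x h1 h' hr h2
        have hx : x ≤ e h ∧ ∃ h', r h' h ∧ x ≤ e h' := ⟨h1, h', hr, h2⟩
        simp only [s, dif_pos hx]
        rw [compat _ h' hx.2.choose_spec.1 hr x _ h2]
      obtain ⟨b, hb0, hb⟩ := hker h s (by
          rintro x y hyx ⟨h1, h', hr, h2⟩
          rw [hs x h1 h' hr h2, hs y (hyx.trans h1) h' hr (hyx.trans h2)]
          simp) (by
          rintro x h1 ⟨h', hr, h2⟩
          rw [hs x h1 h' hr h2, map_sub, app_resMap, app_resMap, ha₀, (ih h' hr).1,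
            hg _ x h1 ⟨h, le_rfl⟩, hg _ x h2 ⟨h', le_rfl⟩, sub_self])
      refine ⟨a₀ - b, ?_, ?_⟩
      · rw [map_sub, ha₀, hb0, sub_zero]
      · intro h' hr x h1 h2
        rw [map_sub, hb x h1 ⟨h', hr, h2⟩, hs x h1 h' hr h2, sub_sub_cancel]
    have ha : a h = hex.choose := by
      change wf.fix _ h = _
      rw [WellFounded.fix_eq]
      exact dif_pos hex
    rw [ha]
    exact hex.choose_spec
  have compat : ∀ h₁ h₂, ∀ (x : Q) (l₁ : x ≤ e h₁) (l₂ : x ≤ e h₂),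
      resMap A l₁ (a h₁) = resMap A l₂ (a h₂) := by
    intro h₁ h₂ x l₁ l₂
    rcases trichotomous_of r h₁ h₂ with h12 | rfl | h21
    · exact ((good h₂).2 h₁ h12 x l₂ l₁).symm
    · rfl
    · exact (good h₁).2 h₂ h21 x l₁ l₂
  let t : ∀ x : Q, A.obj (op x) := fun x =>
    if hx : ∃ h, x ≤ e h then resMap A hx.choose_spec (a hx.choose) else 0
  have ht : ∀ (x : Q) (h : H) (hx : x ≤ e h), t x = resMap A hx (a h) := by
    intro x h hx
    have hx' : ∃ h, x ≤ e h := ⟨h, hx⟩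
    simp only [t, dif_pos hx']
    exact compat _ _ _ _ _
  refine ⟨t, ?_, ?_⟩
  · rintro x y hyx ⟨h, hx⟩
    rw [ht x h hx, ht y h (hyx.trans hx), resMap_resMap]
  · rintro x ⟨h, hx⟩
    rw [ht x h hx, app_resMap, (good h).1, hg _ x hx ⟨h, le_rfl⟩]

end Sections

/-! ### Sections of injective functors extend -/

section Injective

variable {R : Type u} [CommRing R] [Small.{w} R] {Q : Type v} [PartialOrder Q]

/-- The functor on `Qᵒᵖ` with value `R` on the lower set `U` and `0` elsewhere, realised by
submodules of (a small copy of) `R`.  Maps from it to `A` correspond to sections of `A` over `U`. -/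
noncomputable def extendByZero (R : Type u) [CommRing R] [Small.{w} R] {Q : Type v} [PartialOrder Q]
    (U : LowerSet Q) : Qᵒᵖ ⥤ ModuleCat.{w} R :=
  let N : Q → Submodule R (Shrink.{w} R) := fun x =>
    { carrier := {r | x ∉ U → r = 0}
      add_mem' := fun {a b} ha hb hx => by rw [ha hx, hb hx, add_zero]
      zero_mem' := fun _ => rfl
      smul_mem' := fun c a ha hx => by rw [ha hx, smul_zero] }
  { obj := fun x => ModuleCat.of R (N x.unop)
    map := fun {x y} f => ModuleCat.ofHom (Submodule.inclusion (p := N x.unop) (p' := N y.unop)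
      fun _ hr hy => hr fun hx => hy (U.lower (leOfHom f.unop) hx)) }

/-- The inclusion of extensions by zero for lower sets `U ≤ V`. -/
noncomputable def extendByZeroMap (R : Type u) [CommRing R] [Small.{w} R] {U V : LowerSet Q} (h : U ≤ V) :
    extendByZero.{u, v, w} R U ⟶ extendByZero.{u, v, w} R V where
  app _ := ModuleCat.ofHom
    { toFun := fun r => ⟨r.1, fun hx => r.2 fun hU => hx (h hU)⟩
      map_add' := fun _ _ => rfl
      map_smul' := fun _ _ => rfl }
  naturality _ _ _ := rfl

instance mono_extendByZeroMap {U V : LowerSet Q} (h : U ≤ V) :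
    Mono (extendByZeroMap.{u, v, w} R h) := by
  have : ∀ x, Mono ((extendByZeroMap.{u, v, w} R h).app x) := fun x => by
    rw [ModuleCat.mono_iff_injective]
    intro a b hab
    exact Subtype.ext (congrArg (fun r : (extendByZero.{u, v, w} R V).obj x => r.1) hab)
  exact NatTrans.mono_of_mono_app _

/-- The map from the extension by zero of `R` on `U` that corresponds to a section over `U`. -/
noncomputable def sectionHom {A : Qᵒᵖ ⥤ ModuleCat.{w} R} {U : LowerSet Q}
    {s : ∀ x : Q, A.obj (op x)} (hs : IsSectionOn A U s) : extendByZero.{u, v, w} R U ⟶ A where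
  app x := ModuleCat.ofHom
    { toFun := fun r => Shrink.linearEquiv R R r.1 • s x.unop
      map_add' := fun a b => by
        rw [← add_smul, ← map_add]; rfl
      map_smul' := fun c a => by
        rw [RingHom.id_apply, smul_smul, ← smul_eq_mul, ← map_smul]; rfl }
  naturality x y f := by
    ext r
    change Shrink.linearEquiv R R r.1 • s y.unop =
      resMap A (leOfHom f.unop) (Shrink.linearEquiv R R r.1 • s x.unop)
    by_cases hx : x.unop ∈ U
    · rw [map_smul, hs _ _ _ hx]
    · rw [r.2 hx]; simp

/-- A section of an injective functor over a lower set `U ⊆ Q_{≤ p}` extends to `Q_{≤ p}`, because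
the extension by zero of `R` on `U` is a subobject of the one on `Q_{≤ p}`. -/
theorem exists_resMap_eq_of_injective (A : Qᵒᵖ ⥤ ModuleCat.{w} R) [Injective A] (U : LowerSet Q)
    (p : Q) (hp : ∀ x ∈ U, x ≤ p) (s : ∀ x : Q, A.obj (op x)) (hs : IsSectionOn A U s) :
    ∃ a : A.obj (op p), ∀ x (hx : x ∈ U), resMap A (hp x hx) a = s x := by
  have hle : U ≤ LowerSet.Iic p := hp
  let φ : extendByZero.{u, v, w} R (LowerSet.Iic p) ⟶ A :=
    Injective.factorThru (sectionHom hs) (extendByZeroMap R hle)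
  have hφ : extendByZeroMap R hle ≫ φ = sectionHom hs := Injective.comp_factorThru _ _
  let one : Shrink.{w} R := (Shrink.linearEquiv R R).symm 1
  let a₁ : (extendByZero.{u, v, w} R (LowerSet.Iic p)).obj (op p) :=
    ⟨one, fun h => absurd (le_refl p) h⟩
  refine ⟨(φ.app (op p)).hom a₁, fun x hx => ?_⟩
  rw [← app_resMap]
  let b : (extendByZero.{u, v, w} R U).obj (op x) := ⟨one, fun h => absurd hx h⟩
  have h1 : resMap (extendByZero.{u, v, w} R (LowerSet.Iic p)) (hp x hx) a₁ =
      ((extendByZeroMap R hle).app (op x)).hom b := rfl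
  have h2 : (φ.app (op x)).hom (((extendByZeroMap R hle).app (op x)).hom b) =
      ((sectionHom hs).app (op x)).hom b := by
    rw [← hφ]; rfl
  rw [h1, h2]
  change Shrink.linearEquiv R R ((Shrink.linearEquiv R R).symm 1) • s x = s x
  rw [LinearEquiv.apply_symm_apply, one_smul]

end Injective

/-! ### Elements of limits -/

section Limits

variable {R : Type u} [CommRing R] [Small.{w} R] {Q : Type v} [PartialOrder Q] [Small.{w} Q]

/-- The map `R → M`, `1 ↦ m`, with `R` replaced by its copy in the universe of `M`. -/
noncomputable def elementHom (R : Type u) [CommRing R] [Small.{w} R] {M : ModuleCat.{w} R} (m : M) :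
    ModuleCat.of R (Shrink.{w} R) ⟶ M :=
  ModuleCat.ofHom (LinearMap.toSpanSingleton R M m ∘ₗ (Shrink.linearEquiv R R).toLinearMap)

theorem elementHom_comp {M N : ModuleCat.{w} R} (m : M) (f : M ⟶ N) :
    elementHom R m ≫ f = elementHom R (f.hom m) := by
  ext r
  change f.hom (Shrink.linearEquiv R R r • m) = Shrink.linearEquiv R R r • f.hom m
  rw [map_smul]

theorem elementHom_one {M : ModuleCat.{w} R} (m : M) :
    (elementHom R m).hom ((Shrink.linearEquiv R R).symm 1) = m := by
  change Shrink.linearEquiv R R ((Shrink.linearEquiv R R).symm 1) • m = m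
  rw [LinearEquiv.apply_symm_apply, one_smul]

theorem exists_limit_element (A : Qᵒᵖ ⥤ ModuleCat.{w} R) (s : ∀ x : Q, A.obj (op x))
    (hs : IsSectionOn A Set.univ s) :
    ∃ z : ↑(limit A : ModuleCat.{w} R), ∀ x : Q, (limit.π A (op x)).hom z = s x := by
  let c : Cone A :=
    { pt := ModuleCat.of R (Shrink.{w} R)
      π :=
        { app := fun x => elementHom R (s x.unop)
          naturality := fun x y f => by
            rw [elementHom_comp]
            refine (Category.id_comp _).trans (congrArg _ ?_)
            exact (hs _ _ (leOfHom f.unop) trivial).symm } }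
  refine ⟨(limit.lift A c).hom ((Shrink.linearEquiv R R).symm 1), fun x => ?_⟩
  have h : limit.lift A c ≫ limit.π A (op x) = elementHom R (s x) := limit.lift_π c (op x)
  rw [← elementHom_one (R := R) (s x), ← h]
  rfl

theorem limit_element_ext (A : Qᵒᵖ ⥤ ModuleCat.{w} R) {z z' : ↑(limit A : ModuleCat.{w} R)}
    (h : ∀ x : Q, (limit.π A (op x)).hom z = (limit.π A (op x)).hom z') : z = z' := by
  have hz : elementHom R z = elementHom R z' := by
    apply limit.hom_ext
    rintro ⟨x⟩
    rw [elementHom_comp, elementHom_comp]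
    exact congrArg _ (h x)
  rw [← elementHom_one (R := R) z, hz, elementHom_one]

omit [Small.{w} R] in
theorem isSectionOn_limit_element (A : Qᵒᵖ ⥤ ModuleCat.{w} R) (z : ↑(limit A : ModuleCat.{w} R))
    (U : Set Q) : IsSectionOn A U fun x => (limit.π A (op x)).hom z := by
  intro x y h _
  change (limit.π A (op x) ≫ A.map (homOfLE h).op).hom z = (limit.π A (op y)).hom z
  rw [limit.w]

end Limits

/-! ### Stability along the resolution -/

section Stable

variable {R : Type u} [CommRing R] {P : Type v} [PartialOrder P] [BoundedOrder P]

theorem FilteredPoset.exists_le_covBy_top (hP : FilteredPoset P) {x : P} (hx : x ≠ ⊤) :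
    ∃ y, x ≤ y ∧ y ⋖ ⊤ := by
  by_cases h : x ⋖ ⊤
  · exact ⟨x, le_rfl, h⟩
  · obtain ⟨z, hxz, hz⟩ := (not_covBy_iff (lt_top_iff_ne_top.2 hx)).1 h
    obtain ⟨y, hzy, hy⟩ := hP.exists_le_covBy_top hz.ne
    exact ⟨y, hxz.le.trans hzy, hy⟩
termination_by posetDeg (⊤ : P) - posetDeg x
decreasing_by
  have h1 := hP.strictMono_posetDeg hxz
  have h2 := hP.strictMono_posetDeg hz
  omega

theorem CoatomOrdering.lt_of_mem_ideal (O : CoatomOrdering P) {p x : P}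
    {c : UnrefinableChain (⊤ : P) p} (hx : x ∈ O.ideal c) : x < p := by
  obtain ⟨y, -, hxy⟩ := hx
  exact hxy.trans_lt y.2.1

/-- By CL2, `⟨C(c)⟩` for `c = (h ⋖ c')` is the part of `P_{≤ h}` covered by the `P_{≤ h'}` with
`h' ≪_{c'} h`. -/
theorem CoatomOrdering.IsRecursive.mem_ideal_cons_iff {O : CoatomOrdering P} (hO : O.IsRecursive)
    {p : P} (c : UnrefinableChain (⊤ : P) p) (h : {y : P // y ⋖ p}) {x : P} :
    x ∈ O.ideal (.cons h.2 c) ↔ x ≤ h.1 ∧ ∃ h', O.lt c h' h ∧ x ≤ h'.1 := by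
  have := O.isWellOrder c
  constructor
  · rintro ⟨y, ⟨h', hlt, hy⟩, hxy⟩
    exact ⟨hxy.trans y.2.1.le, h', hlt, hxy.trans hy.le⟩
  · rintro ⟨h1, h', hlt, h2⟩
    have hne : h' ≠ h := fun e => irrefl_of (O.lt c) h (by rwa [e] at hlt)
    have l1 : x < h.1 := h1.lt_of_ne fun e =>
      hne (Subtype.ext (by_contra fun n =>
        h.2.2 ((e ▸ h2 : h.1 ≤ h'.1).lt_of_ne (Ne.symm n)) h'.2.1))
    have l2 : x < h'.1 := h2.lt_of_ne fun e =>
      hne (Subtype.ext (by_contra fun n => h'.2.2 ((e ▸ h1 : h'.1 ≤ h.1).lt_of_ne n) h.2.1))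
    obtain ⟨h'', q, hq, hlt', hxq, hq'⟩ := hO.cl2 c h' h hlt x l1 l2
    exact ⟨⟨q, hq⟩, ⟨h'', hlt', hq'⟩, hxq⟩

/-- The kernel of `f : A ⟶ B` is stable at `n`: for every unrefinable `⊤`-chain `c` of length `n`
with least element `p ≠ ⊤`, each section of `ker f` over `⟨C(c)⟩` is the restriction of an element
of `(ker f)(p)`. -/
def IsKerStableAt (O : CoatomOrdering P) {A B : (↥({⊤}ᶜ : Set P))ᵒᵖ ⥤ ModuleCat.{w} R} (f : A ⟶ B)
    (n : ℕ) : Prop :=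
  ∀ (p : ↥({⊤}ᶜ : Set P)) (c : UnrefinableChain (⊤ : P) p.1), c.length = n →
    ∀ s : ∀ x, A.obj (op x), IsSectionOn A {x | x.1 ∈ O.ideal c} s →
      (∀ x, x.1 ∈ O.ideal c → (f.app (op x)).hom (s x) = 0) →
      ∃ a : A.obj (op p), (f.app (op p)).hom a = 0 ∧
        ∀ x (hx : x ≤ p), x.1 ∈ O.ideal c → resMap A hx a = s x

/-- If `ker f` is stable at `n + 1`, then over the lower set generated by an initial segment of
`≪_c`, with `c` of length `n`, every section of `im f` lifts. -/
theorem IsKerStableAt.exists_section_lift {O : CoatomOrdering P} (hO : O.IsRecursive)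
    {A B : (↥({⊤}ᶜ : Set P))ᵒᵖ ⥤ ModuleCat.{w} R} {f : A ⟶ B} {n : ℕ}
    (hf : IsKerStableAt O f (n + 1)) {p : P} (c : UnrefinableChain (⊤ : P) p) (hc : c.length = n)
    (S : Set {x : P // x ⋖ p}) (hS : IsInitialSegment (O.lt c) S) (g : ∀ x, B.obj (op x))
    (hg : IsSectionOn B {x | ∃ h ∈ S, x.1 ≤ h.1} g)
    (hlift : ∀ x, (∃ h ∈ S, x.1 ≤ h.1) → ∃ a, (f.app (op x)).hom a = g x) :
    ∃ t : ∀ x, A.obj (op x), IsSectionOn A {x | ∃ h ∈ S, x.1 ≤ h.1} t ∧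
      ∀ x, (∃ h ∈ S, x.1 ≤ h.1) → (f.app (op x)).hom (t x) = g x := by
  have := O.isWellOrder c
  let e : S → ↥({⊤}ᶜ : Set P) := fun h => ⟨h.1.1, (h.1.2.1.trans_le le_top).ne⟩
  have hU : ∀ x : ↥({⊤}ᶜ : Set P), (∃ h ∈ S, x.1 ≤ h.1) ↔ ∃ h : S, x ≤ e h := fun x =>
    ⟨fun ⟨h, hh, hx⟩ => ⟨⟨h, hh⟩, hx⟩, fun ⟨h, hx⟩ => ⟨h.1, h.2, hx⟩⟩
  have hV : ∀ (h : S) (x : ↥({⊤}ᶜ : Set P)), x.1 ∈ O.ideal (.cons h.1.2 c) ↔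
      x ≤ e h ∧ ∃ h' : S, Subrel (O.lt c) (· ∈ S) h' h ∧ x ≤ e h' := fun h x => by
    rw [hO.mem_ideal_cons_iff c h.1]
    exact and_congr_right fun _ => ⟨fun ⟨h', hr, hx⟩ => ⟨⟨h', hS _ h.2 _ hr⟩, hr, hx⟩,
      fun ⟨h', hr, hx⟩ => ⟨h'.1, hr, hx⟩⟩
  simp only [hU] at hg hlift ⊢
  refine _root_.exists_section_lift f (Subrel (O.lt c) (· ∈ S)) e g hg
    (fun h => hlift _ ⟨h, le_rfl⟩) fun h s hs hs0 => ?_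
  obtain ⟨a, ha, hx⟩ := hf (e h) (.cons h.1.2 c) (congrArg (· + 1) hc) s
    (fun x y hyx hx => hs x y hyx ((hV h x).1 hx))
    (fun x hx => hs0 x ((hV h x).1 hx).1 ((hV h x).1 hx).2)
  exact ⟨a, ha, fun x h1 h2 => hx x h1 ((hV h x).2 ⟨h1, h2⟩)⟩

/-- Dimension shifting: for `A ⟶ B ⟶ D` exact with `A` injective, stability of `ker f` at `n + 1`
gives stability of `ker g = im f` at `n`.  By CL1 a section of `im f` over `⟨C(c)⟩` lifts to `A`,
where it extends by injectivity. -/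
theorem IsKerStableAt.of_exact [Small.{w} R] {O : CoatomOrdering P} (hO : O.IsRecursive)
    {A B D : (↥({⊤}ᶜ : Set P))ᵒᵖ ⥤ ModuleCat.{w} R} [Injective A] {f : A ⟶ B} {g : B ⟶ D}
    (hfg : ∀ x (a : A.obj (op x)), (g.app (op x)).hom ((f.app (op x)).hom a) = 0)
    (hex : ∀ x (b : B.obj (op x)), (g.app (op x)).hom b = 0 → ∃ a, (f.app (op x)).hom a = b)
    {n : ℕ} (hf : IsKerStableAt O f (n + 1)) : IsKerStableAt O g n := by
  intro p c hc s hs hs0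
  obtain ⟨t, ht, hts⟩ := hf.exists_section_lift hO c hc (O.C c) (hO.cl1 c) s hs
    fun x hx => hex x _ (hs0 x hx)
  obtain ⟨a, ha⟩ := exists_resMap_eq_of_injective A
    ⟨{x | x.1 ∈ O.ideal c}, fun x y hyx ⟨h, hh, hx⟩ => ⟨h, hh, le_trans hyx hx⟩⟩ p
    (fun x hx => O.le_of_mem_ideal c x hx) t ht
  refine ⟨(f.app (op p)).hom a, hfg p a, fun x hx hxc => ?_⟩
  rw [← app_resMap, ha x hxc, hts x hxc]

/-- If `F → A → B` is exact and `F → A` is injective, then stability of `F` at `n` is stability of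
`ker (A ⟶ B)` at `n`. -/
theorem IsStableAt.isKerStableAt [Small.{w} R] [Small.{w} P] {O : CoatomOrdering P}
    {F : Pᵒᵖ ⥤ ModuleCat.{w} R} {n : ℕ} (hF : IsStableAt O F n)
    {A B : (↥({⊤}ᶜ : Set P))ᵒᵖ ⥤ ModuleCat.{w} R} (j : restrictTo F {⊤}ᶜ ⟶ A) (f : A ⟶ B)
    (hj : ∀ x, Function.Injective (j.app (op x)).hom)
    (hjf : ∀ x a, (f.app (op x)).hom ((j.app (op x)).hom a) = 0)
    (hex : ∀ x (b : A.obj (op x)), (f.app (op x)).hom b = 0 → ∃ a, (j.app (op x)).hom a = b) :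
    IsKerStableAt O f n := by
  intro p c hc s hs hs0
  have hne : ∀ x ∈ O.ideal c, x ∈ ({⊤}ᶜ : Set P) := fun x hx =>
    ((O.lt_of_mem_ideal hx).trans_le le_top).ne
  choose t ht using fun x hx => hex x (s x) (hs0 x hx)
  obtain ⟨z, hz⟩ := exists_limit_element (restrictTo F (O.ideal c))
    (fun x => t ⟨x.1, hne x.1 x.2⟩ x.2) (by
      intro x y hyx _
      apply hj ⟨y.1, hne y.1 y.2⟩
      rw [ht]
      have h := hs ⟨x.1, hne x.1 x.2⟩ ⟨y.1, hne y.1 y.2⟩ hyx x.2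
      rw [← ht _ x.2, ← app_resMap] at h
      exact h)
  obtain ⟨a, ha⟩ := hF p.1 c hc z
  refine ⟨(j.app (op p)).hom a, hjf p a, fun x hx hxc => ?_⟩
  have h : t x hxc = resMap (restrictTo F {⊤}ᶜ) hx a := by
    refine (hz ⟨x.1, hxc⟩).symm.trans ?_
    rw [← ha]
    change (toLim F p.1 (O.ideal c) (O.le_of_mem_ideal c) ≫
      limit.π (restrictTo F (O.ideal c)) (op ⟨x.1, hxc⟩)).hom a = _
    rw [toLim, limit.lift_π]
    rfl
  refine (app_resMap j hx a).symm.trans ?_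
  rw [← h, ht]

end Stable

/-! ### Higher limits from an injective resolution -/

theorem exact_app {R : Type u} [CommRing R] {Q : Type v} [PartialOrder Q]
    {S : ShortComplex (Qᵒᵖ ⥤ ModuleCat.{w} R)} (hS : S.Exact) (x : Qᵒᵖ) (b : S.X₂.obj x)
    (hb : (S.g.app x).hom b = 0) : ∃ a, (S.f.app x).hom a = b :=
  (ShortComplex.moduleCat_exact_iff _).1
    (hS.map ((evaluation Qᵒᵖ (ModuleCat.{w} R)).obj x)) b hb

theorem app_injective {R : Type u} [CommRing R] {Q : Type v} [PartialOrder Q]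
    {A B : Qᵒᵖ ⥤ ModuleCat.{w} R} (j : A ⟶ B) [Mono j] (x : Qᵒᵖ) :
    Function.Injective (j.app x).hom := by
  have : HasLimitsOfShape WalkingCospan (ModuleCat.{w} R) :=
    (ModuleCat.hasLimitsOfSize.{0, 0, w} (R := R)).has_limits_of_shape _
  exact (ModuleCat.mono_iff_injective _).1 ((NatTrans.mono_iff_mono_app j).1 inferInstance x)

/-- `H^{n+1}(Q; G)` vanishes as soon as, in an injective resolution of `G`, every global section
of `ker (I^{n+1} → I^{n+2})` lifts to `I^n`. -/
theorem isZero_posetCohomology_succ {R : Type u} [CommRing R] [Small.{w} R] {Q : Type v}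
    [PartialOrder Q] [Small.{w} Q] {G : Qᵒᵖ ⥤ ModuleCat.{w} R} (I : InjectiveResolution G) (n : ℕ)
    (h : ∀ g : ∀ x : Q, (I.cocomplex.X (n + 1)).obj (op x), IsSectionOn _ Set.univ g →
      (∀ x, ((I.cocomplex.d (n + 1) (n + 2)).app (op x)).hom (g x) = 0) →
      ∃ t : ∀ x : Q, (I.cocomplex.X n).obj (op x), IsSectionOn _ Set.univ t ∧
        ∀ x, ((I.cocomplex.d n (n + 1)).app (op x)).hom (t x) = g x) :
    IsZero (posetCohomology Q G (n + 1)) := by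
  refine IsZero.of_iso ?_ (I.isoRightDerivedObj lim (n + 1))
  refine (HomologicalComplex.exactAt_iff_isZero_homology _ _).1 ?_
  rw [HomologicalComplex.exactAt_iff' _ n (n + 1) (n + 2) (by simp) (by simp),
    ShortComplex.moduleCat_exact_iff]
  intro (z : ↑(limit (I.cocomplex.X (n + 1))))
    (hz : (limMap (I.cocomplex.d (n + 1) (n + 2))).hom z = 0)
  have key : ∀ (i j : ℕ) (y : ↑(limit (I.cocomplex.X i))) (x : Q),
      (limit.π (I.cocomplex.X j) (op x)).hom ((limMap (I.cocomplex.d i j)).hom y) =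
        ((I.cocomplex.d i j).app (op x)).hom ((limit.π (I.cocomplex.X i) (op x)).hom y) := by
    intro i j y x
    change (limMap (I.cocomplex.d i j) ≫ limit.π (I.cocomplex.X j) (op x)).hom y = _
    rw [limMap_π]
    rfl
  obtain ⟨t, ht, htz⟩ := h _ (isSectionOn_limit_element _ z _) fun x => by
    rw [← key, hz, map_zero]
  obtain ⟨y, hy⟩ := exists_limit_element _ t ht
  refine ⟨y, limit_element_ext _ fun x => ?_⟩
  refine (key n (n + 1) y x).trans ?_
  rw [hy, htz]

theorem mainTheorem1 {R : Type u} [CommRing R] [Small.{w} R]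
    {P : Type v} [PartialOrder P] [BoundedOrder P] [Small.{w} P]
    (O : CoatomOrdering P) (hO : IsDualCLShellable P O)
    (i : ℕ) (hi : 1 ≤ i) (hid : (i : ℕ∞) ≤ posetDegree P - 1)
    (F : Pᵒᵖ ⥤ ModuleCat.{w} R) (hF : IsStableAt O F i) :
    IsZero (posetCohomology (↥({⊤}ᶜ : Set P)) (restrictTo F {⊤}ᶜ) i) := by
  obtain ⟨n, rfl⟩ := Nat.exists_eq_add_of_le' hi
  let I := InjectiveResolution.of (restrictTo F ({⊤}ᶜ : Set P))
  have hdd : ∀ j x (a : (I.cocomplex.X j).obj (op x)),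
      ((I.cocomplex.d (j + 1) (j + 2)).app (op x)).hom
        (((I.cocomplex.d j (j + 1)).app (op x)).hom a) = 0 := fun j x a => by
    change ((I.cocomplex.d j (j + 1) ≫ I.cocomplex.d (j + 1) (j + 2)).app (op x)).hom a = 0
    rw [I.complex_d_comp]
    rfl
  have hstable : ∀ j m, j + m = n + 1 → IsKerStableAt O (I.cocomplex.d j (j + 1)) m := by
    intro j
    induction j with
    | zero =>
      rintro m h
      obtain rfl : m = n + 1 := by omega
      refine hF.isKerStableAt (I.ι.f 0) (I.cocomplex.d 0 1) (fun x => ?_) (fun x a => ?_)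
        fun x => exact_app I.exact₀ (op x)
      · exact app_injective (I.ι.f 0) (op x)
      · change ((I.ι.f 0 ≫ I.cocomplex.d 0 1).app (op x)).hom a = 0
        rw [I.ι_f_zero_comp_complex_d]
        rfl
    | succ j ih =>
      intro m h
      have := I.injective j
      exact (ih (m + 1) (by omega)).of_exact hO.recursive (hdd j)
        fun x => exact_app (I.exact_succ j) (op x)
  refine isZero_posetCohomology_succ I n fun g hg hg0 => ?_
  -- Every element of `P ∖ {⊤}` lies below a coatom, so the coatoms generate all of it.
  have huniv : {x : ↥({⊤}ᶜ : Set P) | ∃ h ∈ (Set.univ : Set {x : P // x ⋖ ⊤}), x.1 ≤ h.1} =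
      Set.univ := Set.eq_univ_of_forall fun x =>
    let ⟨y, hxy, hy⟩ := hO.filtered.exists_le_covBy_top x.2
    ⟨⟨y, hy⟩, trivial, hxy⟩
  obtain ⟨t, ht, htg⟩ := (hstable n 1 rfl).exists_section_lift hO.recursive .nil rfl Set.univ
    (fun _ _ _ _ => trivial) g (huniv ▸ hg) fun x _ => exact_app (I.exact_succ n) (op x) _ (hg0 x)
  exact ⟨t, huniv ▸ ht, fun x => htg x ((Set.ext_iff.1 huniv x).2 trivial)⟩
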